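/- Let $V:(0,\infty)\to\mathbb C^{n\times n}$ be a measurable potential with $V(x)^\dagger=V(x)$ and $\int_0^\infty(1+x)\,|V(x)|\,dx<\infty$, and let $A,B\in\mathbb C^{n\times n}$ satisfy $-B^\dagger A+A^\dagger B=0$ and $A^\dagger A+B^\dagger B>0$. Consider $-\psi''+V(x)\psi=k^2\psi$ on the half line, with the regular solution $\varphi(k,x)$, $\varphi(k,0)=A$, $\varphi'(k,0)=B$, the Jost solution $f(k,x)=e^{ikx}[I+o(1)]$ as $x\to+\infty$ (for $k\ne0$, $\operatorname{Im}k\ge0$), and the Jost matrix $J(k)=f(-k^*,0)^\dagger B-f'(-k^*,0)^\dagger A$. Let $k=i\kappa_N$ with $\kappa_N>0$ be any bound state, i.e. $\det J(i\kappa_N)=0$. Let $Q_N$ be the orthogonal projection of $\mathbb C^n$ onto $\operatorname{Ker}J(i\kappa_N)$, let $$\mathbf H_N=I-Q_N+\int_0^\infty Q_N\,\varphi(i\kappa_N,x)^\dagger\varphi(i\kappa_N,x)\,Q_N\,dx,\qquad C_N=\mathbf H_N^{-1/2}Q_N,$$ $$\Phi_N(x)=\varphi(i\kappa_N,x)\,C_N,\qquad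 W_N(x)=\int_x^\infty\Phi_N(z)^\dagger\,\Phi_N(z)\,dz,$$ and let $W_N(x)^+$ denote the Moore–Penrose inverse of $W_N(x)$. Then the integrals defining $\mathbf H_N$ and $W_N(x)$ converge absolutely, $\mathbf H_N$ is positive definite, and for every $x\ge 0$ the matrix $W_N(x)$ maps the range of $Q_N$ bijectively onto itself. Moreover, with the kernel $$G(x,y)=-\varphi(i\kappa_N,x)\,C_N^2\,\varphi(i\kappa_N,y)^\dagger,$$ the Gel'fand–Levitan system $$\mathcal A(x,y)+G(x,y)+\int_0^x\mathcal A(x,z)\,G(z,y)\,dz=0,\qquad 0\le y<x,$$ has the solution $$\mathcal A(x,y)=\Phi_N(x)\,W_N(x)^+\,\Phi_N(y)^\dagger,\qquad 0\le y<x,$$ and this is its only solution for which $\mathcal A(x,\cdot)$ is integrable on $(0,x)$ for every $x>0$. -/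

import Mathlib

open MeasureTheory Set Filter Topology
open scoped Matrix Matrix.Norms.L2Operator MatrixOrder ComplexOrder

namespace MatrixSchrodinger

noncomputable section

/-- The `x`-derivative of a matrix-valued function on the half line `[0, ∞)`
(one-sided at the endpoint `0`). -/
def xDeriv {n : ℕ} (ψ : ℝ → Matrix (Fin n) (Fin n) ℂ) (x : ℝ) : Matrix (Fin n) (Fin n) ℂ :=
  derivWithin ψ (Ici 0) x

/-- `ψ` is an `n × n` matrix solution on the half line of `-ψ'' + V ψ = k² ψ` with a potential `V`
that is only assumed to be integrable: `ψ` is differentiable on `[0, ∞)`, and `ψ'` is an indefinite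
integral of `ψ'' = (V - k²) ψ`, that is, `ψ'` is locally absolutely continuous and the
equation holds almost everywhere. -/
def IsSolution {n : ℕ} (V : ℝ → Matrix (Fin n) (Fin n) ℂ) (k : ℂ)
    (ψ : ℝ → Matrix (Fin n) (Fin n) ℂ) : Prop :=
  DifferentiableOn ℝ ψ (Ici 0) ∧
    ∀ x : ℝ, 0 ≤ x →
      xDeriv ψ x = xDeriv ψ 0 + ∫ t in (0 : ℝ)..x, (V t * ψ t - k ^ 2 • ψ t)

/-- `φ` is the regular solution: it has the initial values `φ(0) = A`, `φ'(0) = B`. -/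
def IsRegularSolution {n : ℕ} (V : ℝ → Matrix (Fin n) (Fin n) ℂ)
    (A B : Matrix (Fin n) (Fin n) ℂ) (k : ℂ) (φ : ℝ → Matrix (Fin n) (Fin n) ℂ) : Prop :=
  IsSolution V k φ ∧ φ 0 = A ∧ xDeriv φ 0 = B

/-- `f` is the Jost solution: `f(x) = e^{ikx} (I + o(1))` as `x → ∞`. -/
def IsJostSolution {n : ℕ} (V : ℝ → Matrix (Fin n) (Fin n) ℂ) (k : ℂ)
    (f : ℝ → Matrix (Fin n) (Fin n) ℂ) : Prop :=
  IsSolution V k f ∧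
    Tendsto (fun x : ℝ => Complex.exp (-(Complex.I * k * (x : ℂ))) • f x) atTop (𝓝 1)

/-- The Jost matrix `J(k) = f(-k*, 0)† B - f'(-k*, 0)† A`, where `f k x` is the Jost solution. -/
def jostMatrix {n : ℕ} (f : ℂ → ℝ → Matrix (Fin n) (Fin n) ℂ)
    (A B : Matrix (Fin n) (Fin n) ℂ) (k : ℂ) : Matrix (Fin n) (Fin n) ℂ :=
  (f (-(starRingEnd ℂ k)) 0)ᴴ * B - (xDeriv (f (-(starRingEnd ℂ k))) 0)ᴴ * A

/-- The matrix of the orthogonal projection of `ℂⁿ` onto the kernel of `M`. -/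
def kernelProjection {n : ℕ} (M : Matrix (Fin n) (Fin n) ℂ) : Matrix (Fin n) (Fin n) ℂ :=
  (Matrix.toEuclideanCLM (n := Fin n) (𝕜 := ℂ)).symm
    (LinearMap.ker (Matrix.toEuclideanLin M)).starProjection

/-- The four Penrose equations, saying that `X` is the Moore–Penrose inverse of `M`. -/
def IsMoorePenroseInverse {n : ℕ} (M X : Matrix (Fin n) (Fin n) ℂ) : Prop :=
  M * X * M = M ∧ X * M * X = X ∧ (M * X)ᴴ = M * X ∧ (X * M)ᴴ = X * M

theorem IsMoorePenroseInverse.unique {n : ℕ} {M X Y : Matrix (Fin n) (Fin n) ℂ}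
    (hX : IsMoorePenroseInverse M X) (hY : IsMoorePenroseInverse M Y) : X = Y := by
  obtain ⟨a1, a2, a3, a4⟩ := hX
  obtain ⟨b1, b2, b3, b4⟩ := hY
  have h1 : M * X = M * Y := by
    calc M * X = (M * X)ᴴ := a3.symm
      _ = (M * Y * M * X)ᴴ := by rw [b1]
      _ = ((M * Y) * (M * X))ᴴ := by simp only [Matrix.mul_assoc]
      _ = (M * X)ᴴ * (M * Y)ᴴ := Matrix.conjTranspose_mul _ _
      _ = (M * X * M) * Y := by rw [a3, b3]; simp only [Matrix.mul_assoc]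
      _ = M * Y := by rw [a1]
  have h2 : X * M = Y * M := by
    calc X * M = (X * M)ᴴ := a4.symm
      _ = (X * (M * Y * M))ᴴ := by rw [b1]
      _ = ((X * M) * (Y * M))ᴴ := by simp only [Matrix.mul_assoc]
      _ = (Y * M)ᴴ * (X * M)ᴴ := Matrix.conjTranspose_mul _ _
      _ = Y * (M * X * M) := by rw [a4, b4]; simp only [Matrix.mul_assoc]
      _ = Y * M := by rw [a1]
  calc X = X * M * X := a2.symm
    _ = Y * (M * X) := by rw [h2, Matrix.mul_assoc]
    _ = Y := by rw [h1, ← Matrix.mul_assoc, b2]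

theorem exists_isMoorePenroseInverse {n : ℕ} (M : Matrix (Fin n) (Fin n) ℂ) :
    ∃ X, IsMoorePenroseInverse M X := by
  have hH : IsSelfAdjoint (Mᴴ * M) := Matrix.isHermitian_conjTranspose_mul_self M
  have hc : ∀ g : ℝ → ℝ, ContinuousOn g (spectrum ℝ (Mᴴ * M)) := fun g =>
    (Matrix.finite_real_spectrum).continuousOn g
  set H := Mᴴ * M with hHdef
  set X := cfc (fun x : ℝ => x⁻¹) H with hX
  have hid : cfc (fun x : ℝ => x) H = H := cfc_id' ℝ H
  have hXs : Xᴴ = X := (IsSelfAdjoint.star_eq (cfc_predicate (fun x : ℝ => x⁻¹) H) : star X = X)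
  have hHs : Hᴴ = H := (IsSelfAdjoint.star_eq hH : star H = H)
  have hHX : H * X = cfc (fun x : ℝ => x * x⁻¹) H := by
    rw [cfc_mul _ _ H (hc _) (hc _), hid]
  have hXH : X * H = H * X := by
    rw [hHX]
    have : (fun x : ℝ => x * x⁻¹) = fun x : ℝ => x⁻¹ * x := by funext x; ring
    rw [this, cfc_mul _ _ H (hc _) (hc _), hid]
  have h1 : H * X * H = H := by
    have : H * X * H = cfc (fun x : ℝ => x * x⁻¹ * x) H := by
      rw [cfc_mul _ _ H (hc _) (hc _), hid, hHX]
    rw [this]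
    simp only [mul_inv_mul_cancel]
    exact hid
  have h2 : X * H * X = X := by
    have : X * H * X = cfc (fun x : ℝ => x * x⁻¹ * x⁻¹) H := by
      rw [cfc_mul _ _ H (hc _) (hc _), hXH, hHX]
    rw [this, hX]
    congr 1
    funext x
    by_cases hx : x = 0 <;> simp [hx]
  refine ⟨X * Mᴴ, ?_, ?_, ?_, ?_⟩
  · have key : (M * X * H - M)ᴴ * (M * X * H - M) = 0 := by
      have e : (M * X * H - M)ᴴ = H * X * Mᴴ - Mᴴ := by
        simp only [Matrix.conjTranspose_sub, Matrix.conjTranspose_mul, hXs, hHs, Matrix.mul_assoc]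
      have : (H * X * Mᴴ - Mᴴ) * (M * X * H - M)
          = H * X * (Mᴴ * M) * X * H - H * X * (Mᴴ * M) - ((Mᴴ * M) * X * H - Mᴴ * M) := by
        simp only [Matrix.sub_mul, Matrix.mul_sub, Matrix.mul_assoc]
        abel
      rw [e, this, ← hHdef, h1]
      simp [h1]
    have := Matrix.conjTranspose_mul_self_eq_zero.1 key
    have h3 : M * X * H = M := sub_eq_zero.1 this
    calc M * (X * Mᴴ) * M = M * X * H := by rw [hHdef]; simp only [Matrix.mul_assoc]
      _ = M := h3
  · calc X * Mᴴ * M * (X * Mᴴ) = X * H * X * Mᴴ := by rw [hHdef]; simp only [Matrix.mul_assoc]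
      _ = X * Mᴴ := by rw [h2]
  · simp only [Matrix.conjTranspose_mul, Matrix.conjTranspose_conjTranspose, hXs, Matrix.mul_assoc]
  · have : X * Mᴴ * M = X * H := by rw [hHdef]; simp only [Matrix.mul_assoc]
    rw [this, Matrix.conjTranspose_mul, hXs, hHs, hXH]

/-- The Moore–Penrose inverse `M⁺`. -/
def moorePenroseInverse {n : ℕ} (M : Matrix (Fin n) (Fin n) ℂ) : Matrix (Fin n) (Fin n) ℂ :=
  Classical.choose (exists_isMoorePenroseInverse M)

theorem moorePenroseInverse_spec {n : ℕ} (M : Matrix (Fin n) (Fin n) ℂ) :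
    IsMoorePenroseInverse M (moorePenroseInverse M) :=
  Classical.choose_spec (exists_isMoorePenroseInverse M)

/-- The matrix `H = I - Q + ∫₀^∞ Q φ† φ Q`. -/
def normalizationGram {n : ℕ} (Q : Matrix (Fin n) (Fin n) ℂ)
    (φ : ℝ → Matrix (Fin n) (Fin n) ℂ) : Matrix (Fin n) (Fin n) ℂ :=
  1 - Q + ∫ x in Ioi (0 : ℝ), Q * (φ x)ᴴ * φ x * Q

/-- The Gel'fand–Levitan normalization matrix `C = H^{-1/2} Q`. -/
def normalizationMatrix {n : ℕ} (Q : Matrix (Fin n) (Fin n) ℂ)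
    (φ : ℝ → Matrix (Fin n) (Fin n) ℂ) : Matrix (Fin n) (Fin n) ℂ :=
  (CFC.sqrt (normalizationGram Q φ))⁻¹ * Q

/-- The Gel'fand–Levitan normalized bound-state solution `Φ(x) = φ(x) C`. -/
def normalizedSolution {n : ℕ} (Q : Matrix (Fin n) (Fin n) ℂ)
    (φ : ℝ → Matrix (Fin n) (Fin n) ℂ) (x : ℝ) : Matrix (Fin n) (Fin n) ℂ :=
  φ x * normalizationMatrix Q φ

/-- The tail Gram matrix `W(x) = ∫ₓ^∞ Φ† Φ`. -/
def tailGram {n : ℕ} (Φ : ℝ → Matrix (Fin n) (Fin n) ℂ) (x : ℝ) : Matrix (Fin n) (Fin n) ℂ :=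
  ∫ z in Ioi x, (Φ z)ᴴ * Φ z

/-- `a` solves the Gel'fand–Levitan system with kernel `G`:
`a(x,y) + G(x,y) + ∫₀ˣ a(x,z) G(z,y) dz = 0` for `0 ≤ y < x`, with `a(x,·)` integrable on `(0,x)`,
so that the integral is meaningful for a continuous kernel. -/
def IsGelfandLevitanSolution {n : ℕ} (G a : ℝ → ℝ → Matrix (Fin n) (Fin n) ℂ) : Prop :=
  ∀ x : ℝ, 0 < x →
    IntervalIntegrable (fun z => a x z) volume 0 x ∧
      ∀ y : ℝ, 0 ≤ y → y < x →
        a x y + G x y + ∫ z in (0 : ℝ)..x, a x z * G z y = 0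

end

end MatrixSchrodinger

open MatrixSchrodinger

namespace MatrixSchrodinger

section AbsoluteContinuity

theorem absolutelyContinuousOnInterval_of_dist_le {E F G : Type*} [PseudoMetricSpace E]
    [PseudoMetricSpace F] [PseudoMetricSpace G] {f : ℝ → E} {g : ℝ → F} {h : ℝ → G} {a b C D : ℝ}
    (hg : AbsolutelyContinuousOnInterval g a b) (hh : AbsolutelyContinuousOnInterval h a b)
    (hf : ∀ x ∈ uIcc a b, ∀ y ∈ uIcc a b,
      dist (f x) (f y) ≤ C * dist (g x) (g y) + D * dist (h x) (h y)) :
    AbsolutelyContinuousOnInterval f a b := by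
  unfold AbsolutelyContinuousOnInterval at hg hh
  refine squeeze_zero' ?_ ?_ (by simpa using (hg.const_mul C).add (hh.const_mul D))
  · exact Eventually.of_forall fun _ => Finset.sum_nonneg fun _ _ => dist_nonneg
  · rw [eventually_inf_principal]
    refine Eventually.of_forall fun I hI => ?_
    simp only [Finset.mul_sum, ← Finset.sum_add_distrib]
    exact Finset.sum_le_sum fun i hi => hf _ (hI.1 i hi).1 _ (hI.1 i hi).2

theorem absolutelyContinuousOnInterval_integral {E : Type*} [NormedAddCommGroup E]
    [NormedSpace ℝ E] {f : ℝ → E} {a b c : ℝ} (h : IntervalIntegrable f volume a b)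
    (hc : c ∈ uIcc a b) :
    AbsolutelyContinuousOnInterval (fun x => ∫ t in c..x, f t) a b := by
  have hn := h.norm.absolutelyContinuousOnInterval_intervalIntegral hc
  refine absolutelyContinuousOnInterval_of_dist_le (C := 1) (D := 0) hn hn fun x hx y hy => ?_
  have hcx : IntervalIntegrable f volume c x := h.mono_set (uIcc_subset_uIcc hc hx)
  have hcy : IntervalIntegrable f volume c y := h.mono_set (uIcc_subset_uIcc hc hy)
  rw [dist_comm, dist_comm (∫ t in c..x, ‖f t‖), dist_eq_norm, dist_eq_norm,
    intervalIntegral.integral_interval_sub_left hcy hcx,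
    intervalIntegral.integral_interval_sub_left hcy.norm hcx.norm, Real.norm_eq_abs]
  simpa using intervalIntegral.norm_integral_le_abs_integral_norm

theorem absolutelyContinuousOnInterval_mul {R : Type*} [NormedRing R] {f g : ℝ → R} {a b : ℝ}
    (hf : AbsolutelyContinuousOnInterval f a b) (hg : AbsolutelyContinuousOnInterval g a b) :
    AbsolutelyContinuousOnInterval (fun x => f x * g x) a b := by
  obtain ⟨C, hC⟩ := hf.exists_bound
  obtain ⟨D, hD⟩ := hg.exists_bound
  refine absolutelyContinuousOnInterval_of_dist_le (C := D) (D := C) hf hg fun x hx y hy => ?_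
  have e : f x * g x - f y * g y = (f x - f y) * g x + f y * (g x - g y) := by noncomm_ring
  rw [dist_eq_norm, dist_eq_norm, dist_eq_norm, e]
  calc _ ≤ ‖f x - f y‖ * ‖g x‖ + ‖f y‖ * ‖g x - g y‖ :=
        (norm_add_le _ _).trans (add_le_add (norm_mul_le _ _) (norm_mul_le _ _))
    _ ≤ D * ‖f x - f y‖ + C * ‖g x - g y‖ := by
        rw [mul_comm D]
        gcongr
        · exact hD x hx
        · exact hC y hy

theorem absolutelyContinuousOnInterval_star {R : Type*} [NormedRing R] [StarRing R]
    [NormedStarGroup R] {f : ℝ → R} {a b : ℝ} (hf : AbsolutelyContinuousOnInterval f a b) :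
    AbsolutelyContinuousOnInterval (fun x => star (f x)) a b := by
  refine absolutelyContinuousOnInterval_of_dist_le (C := 1) (D := 0) hf hf fun x _ y _ => ?_
  rw [dist_eq_norm, dist_eq_norm, ← star_sub, norm_star]
  simp

end AbsoluteContinuity

section Solutions

variable {n : ℕ} {V ψ χ : ℝ → Matrix (Fin n) (Fin n) ℂ} {k : ℂ}

theorem integrableOn_of_integrableOn_weighted
    (hV : IntegrableOn (fun x : ℝ => (1 + x) • V x) (Ioi 0)) : IntegrableOn V (Ioi 0) := by
  have hm : AEStronglyMeasurable V (volume.restrict (Ioi 0)) := by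
    have h1 : AEStronglyMeasurable (fun x : ℝ => (1 + x)⁻¹ • ((1 + x) • V x))
        (volume.restrict (Ioi 0)) :=
      AEStronglyMeasurable.smul (f := fun x : ℝ => (1 + x)⁻¹)
        (by measurability) hV.aestronglyMeasurable
    refine h1.congr ?_
    filter_upwards [ae_restrict_mem measurableSet_Ioi] with x hx
    have : (1 + x : ℝ) ≠ 0 := by have := mem_Ioi.1 hx; positivity
    rw [smul_smul, inv_mul_cancel₀ this, one_smul]
  refine Integrable.mono hV hm ?_
  filter_upwards [ae_restrict_mem measurableSet_Ioi] with x hx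
  have hx := mem_Ioi.1 hx
  rw [norm_smul, Real.norm_eq_abs, abs_of_pos (by positivity)]
  nlinarith [norm_nonneg (V x)]

theorem IsSolution.continuousOn (h : IsSolution V k ψ) : ContinuousOn ψ (Ici 0) :=
  h.1.continuousOn

theorem IsSolution.hasDerivWithinAt (h : IsSolution V k ψ) {x : ℝ} (hx : 0 ≤ x) :
    HasDerivWithinAt ψ (xDeriv ψ x) (Ici 0) x :=
  (h.1 x hx).hasDerivWithinAt

theorem IsSolution.hasDerivAt (h : IsSolution V k ψ) {x : ℝ} (hx : 0 < x) :
    HasDerivAt ψ (xDeriv ψ x) x :=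
  (h.hasDerivWithinAt hx.le).hasDerivAt (Ici_mem_nhds hx)

theorem intervalIntegrable_of_integrableOn (hV : IntegrableOn V (Ioi 0)) {a b : ℝ} (ha : 0 ≤ a)
    (hb : 0 ≤ b) : IntervalIntegrable V volume a b := by
  rw [intervalIntegrable_iff]
  exact hV.mono_set fun x hx => lt_of_le_of_lt (le_min ha hb) hx.1

theorem uIcc_subset_Ici_zero {a b : ℝ} (ha : 0 ≤ a) (hb : 0 ≤ b) : uIcc a b ⊆ Ici 0 :=
  fun _ hx => (le_min ha hb).trans hx.1

theorem IsSolution.intervalIntegrable (hV : IntegrableOn V (Ioi 0)) (h : IsSolution V k ψ)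
    {a b : ℝ} (ha : 0 ≤ a) (hb : 0 ≤ b) :
    IntervalIntegrable (fun t => V t * ψ t - k ^ 2 • ψ t) volume a b := by
  have hc : ContinuousOn ψ (uIcc a b) := h.continuousOn.mono (uIcc_subset_Ici_zero ha hb)
  have hs : ContinuousOn (fun t => k ^ 2 • ψ t) (uIcc a b) :=
    (continuous_const_smul (k ^ 2)).comp_continuousOn hc
  exact ((intervalIntegrable_of_integrableOn hV ha hb).mul_continuousOn hc).sub
    hs.intervalIntegrable

theorem IsSolution.xDeriv_sub (hV : IntegrableOn V (Ioi 0)) (h : IsSolution V k ψ)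
    {a b : ℝ} (ha : 0 ≤ a) (hb : 0 ≤ b) :
    xDeriv ψ b - xDeriv ψ a = ∫ t in a..b, (V t * ψ t - k ^ 2 • ψ t) := by
  rw [h.2 a ha, h.2 b hb, add_sub_add_left_eq_sub, intervalIntegral.integral_interval_sub_left
    (h.intervalIntegrable hV le_rfl hb) (h.intervalIntegrable hV le_rfl ha)]

theorem IsSolution.absolutelyContinuous_xDeriv (hV : IntegrableOn V (Ioi 0))
    (h : IsSolution V k ψ) {b : ℝ} (hb : 0 ≤ b) :
    AbsolutelyContinuousOnInterval (xDeriv ψ) 0 b := by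
  have hi := absolutelyContinuousOnInterval_integral (h.intervalIntegrable hV le_rfl hb)
    left_mem_uIcc
  refine absolutelyContinuousOnInterval_of_dist_le (C := 1) (D := 0) hi hi fun x hx y hy => ?_
  have hx := uIcc_subset_Ici_zero le_rfl hb hx
  have hy := uIcc_subset_Ici_zero le_rfl hb hy
  rw [h.2 x hx, h.2 y hy, dist_add_left]
  simp

theorem IsSolution.continuousOn_xDeriv (hV : IntegrableOn V (Ioi 0))
    (h : IsSolution V k ψ) {b : ℝ} (hb : 0 ≤ b) : ContinuousOn (xDeriv ψ) (Icc 0 b) := by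
  have := (h.absolutelyContinuous_xDeriv hV hb).continuousOn
  rwa [uIcc_of_le hb] at this

theorem IsSolution.absolutelyContinuous (hV : IntegrableOn V (Ioi 0))
    (h : IsSolution V k ψ) {b : ℝ} (hb : 0 ≤ b) :
    AbsolutelyContinuousOnInterval ψ 0 b := by
  obtain ⟨C, hC⟩ := isCompact_Icc.exists_bound_of_continuousOn (h.continuousOn_xDeriv hV hb)
  have hl : LipschitzOnWith C.toNNReal ψ (uIcc 0 b) := by
    rw [uIcc_of_le hb]
    refine Convex.lipschitzOnWith_of_nnnorm_hasDerivWithin_le (f' := xDeriv ψ) (convex_Icc 0 b)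
      (fun x hx => (h.hasDerivWithinAt hx.1).mono Icc_subset_Ici_self) fun x hx => ?_
    rw [← NNReal.coe_le_coe, coe_nnnorm]
    exact (hC x hx).trans (Real.le_coe_toNNReal C)
  exact hl.absolutelyContinuousOnInterval

theorem IsSolution.ae_hasDerivAt_xDeriv (hV : IntegrableOn V (Ioi 0))
    (h : IsSolution V k ψ) {b : ℝ} (hb : 0 ≤ b) :
    ∀ᵐ x, x ∈ uIcc 0 b → HasDerivAt (xDeriv ψ) (V x * ψ x - k ^ 2 • ψ x) x := by
  have h0 : ∀ᵐ x : ℝ, x ≠ 0 := by simp [ae_iff, measure_singleton]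
  filter_upwards [(h.intervalIntegrable hV le_rfl hb).ae_hasDerivAt_integral, h0] with x hx hx0 hxb
  have hpos : 0 < x := lt_of_le_of_ne (uIcc_subset_Ici_zero le_rfl hb hxb) hx0.symm
  refine ((hx hxb 0 left_mem_uIcc).const_add (xDeriv ψ 0)).congr_of_eventuallyEq ?_
  filter_upwards [Ici_mem_nhds hpos] with y hy using h.2 y hy

theorem IsSolution.mul_const (hV : IntegrableOn V (Ioi 0)) (h : IsSolution V k ψ) 
    (M : Matrix (Fin n) (Fin n) ℂ) :
    IsSolution V k (fun x => ψ x * M) ∧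
      ∀ x, 0 ≤ x → xDeriv (fun x => ψ x * M) x = xDeriv ψ x * M := by
  have hd : ∀ x, 0 ≤ x → xDeriv (fun x => ψ x * M) x = xDeriv ψ x * M := fun x hx =>
    derivWithin_mul_const (h.1 x hx) M
  refine ⟨⟨fun x hx => (h.1 x hx).mul_const M, fun x hx => ?_⟩, hd⟩
  rw [hd x hx, hd 0 le_rfl, h.2 x hx, add_mul]
  congr 1
  have hi := h.intervalIntegrable hV le_rfl hx
  have := (((ContinuousLinearMap.mul ℝ (Matrix (Fin n) (Fin n) ℂ)).flip M).intervalIntegral_comp_comm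
    hi).symm
  simpa [sub_mul, Matrix.mul_assoc] using this

end Solutions

section Wronskian

variable {n : ℕ} {V ψ χ : ℝ → Matrix (Fin n) (Fin n) ℂ} {k : ℂ}

theorem IsSolution.wronskian_eq (hVself : ∀ x : ℝ, 0 < x → (V x).IsHermitian)
    (hV : IntegrableOn V (Ioi 0)) (hk : star (k ^ 2) = k ^ 2)
    (hχ : IsSolution V k χ) (hψ : IsSolution V k ψ) {x : ℝ} (hx : 0 ≤ x) :
    (χ x)ᴴ * xDeriv ψ x - (xDeriv χ x)ᴴ * ψ x = (χ 0)ᴴ * xDeriv ψ 0 - (xDeriv χ 0)ᴴ * ψ 0 := by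
  have s1 := absolutelyContinuousOnInterval_star (hχ.absolutelyContinuous hV hx)
  have s2 := absolutelyContinuousOnInterval_star (hχ.absolutelyContinuous_xDeriv hV hx)
  have h1 := absolutelyContinuousOnInterval_mul s1 (hψ.absolutelyContinuous_xDeriv hV hx)
  have h2 := absolutelyContinuousOnInterval_mul s2 (hψ.absolutelyContinuous hV hx)
  have hac := h1.fun_sub h2
  have hae : ∀ᵐ t, t ∈ uIcc 0 x →
      HasDerivAt (fun x => star (χ x) * xDeriv ψ x - star (xDeriv χ x) * ψ x) 0 t := by
    have h0 : ∀ᵐ t : ℝ, t ≠ 0 := by simp [ae_iff, measure_singleton]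
    filter_upwards [hχ.ae_hasDerivAt_xDeriv hV hx, hψ.ae_hasDerivAt_xDeriv hV hx, h0]
      with t h1 h2 h3 ht
    have hpos : 0 < t := lt_of_le_of_ne (uIcc_subset_Ici_zero le_rfl hx ht) h3.symm
    have hd := (((hχ.hasDerivAt hpos).star).fun_mul (h2 ht)).fun_sub (((h1 ht).star).fun_mul
      (hψ.hasDerivAt hpos))
    have hVs : star (V t) = V t := hVself t hpos
    refine hd.congr_deriv ?_
    rw [star_sub, star_mul, star_smul, hVs, hk]
    simp only [mul_sub, sub_mul, mul_smul_comm, smul_mul_assoc, mul_assoc]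
    abel
  obtain ⟨C, hC⟩ := hac.const_of_ae_hasDerivAt_zero hae
  exact (hC x right_mem_uIcc).trans (hC 0 left_mem_uIcc).symm

theorem IsSolution.eq_zero_of_step (hV : IntegrableOn V (Ioi 0)) (hψ : IsSolution V k ψ)
    {a c X K : ℝ} (ha : 0 ≤ a) (hac : a ≤ c) (hcX : c ≤ X)
    (hK : ∫ t in (0 : ℝ)..X, (‖V t‖ + ‖k ^ 2‖) ≤ K) (hs : K * (c - a) ≤ 1 / 2)
    (h0 : ψ c = 0) (h1 : xDeriv ψ c = 0) : ψ a = 0 ∧ xDeriv ψ a = 0 := by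
  have hsub : Icc a c ⊆ Ici 0 := fun x hx => ha.trans hx.1
  obtain ⟨m, hm, hmax⟩ := isCompact_Icc.exists_isMaxOn (nonempty_Icc.2 hac)
    (hψ.continuousOn.mono hsub).norm
  have hmax : ∀ x ∈ Icc a c, ‖ψ x‖ ≤ ‖ψ m‖ := fun x hx => hmax hx
  set S := ‖ψ m‖ with hS
  have hS0 : 0 ≤ S := norm_nonneg _
  have hVi : ∀ {p q : ℝ}, 0 ≤ p → 0 ≤ q →
      IntervalIntegrable (fun t => ‖V t‖ + ‖k ^ 2‖) volume p q := fun hp hq =>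
    (intervalIntegrable_of_integrableOn hV hp hq).norm.add intervalIntegrable_const
  have hder : ∀ x ∈ Icc a c, ‖xDeriv ψ x‖ ≤ K * S := by
    intro x hx
    have hx0 := ha.trans hx.1
    have hc0 := ha.trans hac
    have e : xDeriv ψ x = -∫ t in x..c, (V t * ψ t - k ^ 2 • ψ t) := by
      rw [← hψ.xDeriv_sub hV hx0 hc0, h1]; simp
    rw [e, norm_neg]
    calc ‖∫ t in x..c, (V t * ψ t - k ^ 2 • ψ t)‖
        ≤ ∫ t in x..c, (‖V t‖ + ‖k ^ 2‖) * S := by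
          refine intervalIntegral.norm_integral_le_of_norm_le hx.2 ?_ ((hVi hx0 hc0).mul_const S)
          refine Eventually.of_forall fun t ht => ?_
          have htS := hmax t ⟨hx.1.trans ht.1.le, ht.2⟩
          calc _ ≤ ‖V t‖ * ‖ψ t‖ + ‖k ^ 2‖ * ‖ψ t‖ :=
                (norm_sub_le _ _).trans (add_le_add (norm_mul_le _ _) (norm_smul _ _).le)
            _ ≤ _ := by rw [← add_mul]; gcongr
      _ = (∫ t in x..c, (‖V t‖ + ‖k ^ 2‖)) * S := intervalIntegral.integral_mul_const _ _
      _ ≤ K * S := by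
          gcongr
          refine le_trans ?_ hK
          refine intervalIntegral.integral_mono_interval hx0 hx.2 hcX ?_ (hVi le_rfl (hc0.trans hcX))
          exact Eventually.of_forall fun t => by positivity
  have hle : ∀ x ∈ Icc a c, ‖ψ x‖ ≤ S / 2 := by
    intro x hx
    have := Convex.norm_image_sub_le_of_norm_hasDerivWithin_le (f := ψ) (f' := xDeriv ψ)
      (fun y hy => (hψ.hasDerivWithinAt (hsub hy)).mono hsub) hder (convex_Icc a c)
      (right_mem_Icc.2 hac) hx
    rw [h0, sub_zero, Real.norm_eq_abs, abs_sub_comm, abs_of_nonneg (by linarith [hx.2])] at this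
    have hK0 : 0 ≤ K := le_trans (intervalIntegral.integral_nonneg (ha.trans (hac.trans hcX))
      fun t _ => by positivity) hK
    have h2 : K * (c - x) ≤ 1 / 2 := le_trans (by gcongr; exact hx.1) hs
    nlinarith
  have hSz : S = 0 := by linarith [hle m hm]
  have ham := left_mem_Icc.2 hac
  constructor
  · exact norm_le_zero_iff.1 (by simpa [hSz] using hmax a ham)
  · exact norm_le_zero_iff.1 (by simpa [hSz] using hder a ham)

theorem IsSolution.eq_zero_at_zero (hV : IntegrableOn V (Ioi 0)) (hψ : IsSolution V k ψ)
    {b : ℝ} (hb : 0 ≤ b) (h0 : ψ b = 0) (h1 : xDeriv ψ b = 0) : ψ 0 = 0 ∧ xDeriv ψ 0 = 0 := by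
  set I := ∫ t in (0 : ℝ)..b, (‖V t‖ + ‖k ^ 2‖) with hI
  have hI0 : 0 ≤ I := intervalIntegral.integral_nonneg hb fun t _ => by positivity
  set δ := 1 / (2 * (I + 1)) with hδ
  have hδ0 : 0 < δ := by positivity
  have hIδ : (I + 1) * δ = 1 / 2 := by rw [hδ]; field_simp
  have key : ∀ N : ℕ, ψ (max 0 (b - N * δ)) = 0 ∧ xDeriv ψ (max 0 (b - N * δ)) = 0 := by
    intro N
    induction N with
    | zero => simpa [hb] using ⟨h0, h1⟩
    | succ N ih =>
      refine hψ.eq_zero_of_step hV (X := b) (K := I + 1) (le_max_left _ _) ?_ ?_ (by linarith) ?_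
        ih.1 ih.2
      · refine max_le_max le_rfl ?_
        push_cast; linarith
      · exact max_le hb (by have : 0 ≤ (N : ℝ) * δ := by positivity
                            linarith)
      · rw [← hIδ]
        refine mul_le_mul_of_nonneg_left ?_ (by linarith)
        push_cast
        rcases max_cases 0 (b - N * δ) with h | h <;>
          rcases max_cases 0 (b - (N + 1) * δ) with h' | h' <;> linarith
  obtain ⟨N, hN⟩ := exists_nat_ge (b / δ)
  have : max 0 (b - N * δ) = 0 := max_eq_left (by rw [div_le_iff₀ hδ0] at hN; linarith)
  simpa [this] using key N

theorem IsRegularSolution.mul_eq_zero {A B : Matrix (Fin n) (Fin n) ℂ}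
    (hV : IntegrableOn V (Ioi 0)) (hAB : (Aᴴ * A + Bᴴ * B).PosDef)
    (hψ : IsRegularSolution V A B k ψ) {M : Matrix (Fin n) (Fin n) ℂ} {x : ℝ} (hx : 0 ≤ x)
    (h : ∀ z, x < z → ψ z * M = 0) : M = 0 := by
  obtain ⟨hs, hA, hB⟩ := hψ
  obtain ⟨hM, hd⟩ := hs.mul_const hV M
  have hx1 : 0 ≤ x + 1 := by linarith
  have hz : xDeriv (fun x => ψ x * M) (x + 1) = 0 := by
    have h1 := hM.hasDerivAt (x := x + 1) (by linarith)
    refine h1.unique ((hasDerivAt_const (x + 1) 0).congr_of_eventuallyEq ?_)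
    filter_upwards [Ioi_mem_nhds (show x < x + 1 by linarith)] with z hz using h z hz
  obtain ⟨e0, e1⟩ := hM.eq_zero_at_zero hV hx1 (h _ (by linarith)) hz
  rw [hd 0 le_rfl, hB] at e1
  simp only [hA] at e0
  have hu : IsUnit (Aᴴ * A + Bᴴ * B) := hAB.isUnit
  have : (Aᴴ * A + Bᴴ * B) * M = 0 := by
    rw [add_mul, Matrix.mul_assoc, Matrix.mul_assoc, e0, e1]; simp
  exact hu.mul_right_eq_zero.1 this

theorem IsRegularSolution.mulVec_eq_zero {A B : Matrix (Fin n) (Fin n) ℂ}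
    (hV : IntegrableOn V (Ioi 0)) (hAB : (Aᴴ * A + Bᴴ * B).PosDef)
    (hψ : IsRegularSolution V A B k ψ) {v : Fin n → ℂ} {x : ℝ} (hx : 0 ≤ x)
    (h : ∀ z, x < z → ψ z *ᵥ v = 0) : v = 0 := by
  have := hψ.mul_eq_zero hV hAB (M := Matrix.vecMulVec v 1) hx fun z hz => by
    rw [Matrix.mul_vecMulVec, h z hz, Matrix.zero_vecMulVec]
  ext i
  simpa [Matrix.vecMulVec_apply] using congrFun (congrFun this i) i

end Wronskian

section Decay

variable {n : ℕ} {V f ψ : ℝ → Matrix (Fin n) (Fin n) ℂ} {κ : ℝ}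

theorem IsJostSolution.tendsto_exp_smul (hf : IsJostSolution V (Complex.I * κ) f) :
    Tendsto (fun x : ℝ => Real.exp (κ * x) • f x) atTop (𝓝 1) := by
  refine hf.2.congr fun x => ?_
  have : -(Complex.I * (Complex.I * κ) * x) = ((κ * x : ℝ) : ℂ) := by
    rw [← mul_assoc, Complex.I_mul_I]; push_cast; ring
  rw [this, ← Complex.ofReal_exp]
  ext i j
  simp

theorem IsJostSolution.isBigO_exp (hf : IsJostSolution V (Complex.I * κ) f) :
    f =O[atTop] fun x => Real.exp (-κ * x) := by
  have h := (Asymptotics.isBigO_refl (fun x => Real.exp (-κ * x)) atTop).smul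
    (hf.tendsto_exp_smul.isBigO_one ℝ)
  refine (h.congr_left fun x => ?_).congr_right fun x => ?_
  · rw [smul_smul, ← Real.exp_add]; simp
  · simp

theorem IsJostSolution.eventually_isUnit (hf : IsJostSolution V (Complex.I * κ) f) :
    ∀ᶠ x in atTop, IsUnit (f x) := by
  filter_upwards [hf.tendsto_exp_smul.eventually (Units.isOpen.mem_nhds isUnit_one)] with x hx
  have : f x = Real.exp (-(κ * x)) • (1 : Matrix (Fin n) (Fin n) ℂ) * (Real.exp (κ * x) • f x) := by
    rw [smul_mul_smul_comm, ← Real.exp_add]; simp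
  rw [this]
  refine IsUnit.mul ?_ hx
  exact (isUnit_iff_exists_inv.2 ⟨Real.exp (κ * x) • 1, by
    rw [smul_mul_smul_comm, ← Real.exp_add]; simp⟩)

theorem IsJostSolution.tendsto_zero (hκ : 0 < κ) (hf : IsJostSolution V (Complex.I * κ) f) :
    Tendsto f atTop (𝓝 0) := by
  refine hf.isBigO_exp.trans_tendsto ?_
  refine Real.tendsto_exp_atBot.comp ?_
  exact tendsto_id.const_mul_atTop_of_neg (by linarith)

theorem IsJostSolution.xDeriv_bounded (hV : IntegrableOn V (Ioi 0)) (hκ : 0 < κ)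
    (hf : IsJostSolution V (Complex.I * κ) f) : ∃ C, ∀ x, 0 ≤ x → ‖xDeriv f x‖ ≤ C := by
  have hc : ContinuousOn f (Ici 0) := hf.1.continuousOn
  have hfi : IntegrableOn (fun x => ‖f x‖) (Ioi 0) :=
    integrable_of_isBigO_exp_neg hκ hc.norm hf.isBigO_exp.norm_left
  obtain ⟨D, hD⟩ : ∃ D, ∀ x, 0 ≤ x → ‖f x‖ ≤ D := by
    obtain ⟨R, hR⟩ := eventually_atTop.1
      ((hf.tendsto_zero hκ).norm.eventually (gt_mem_nhds (by simp : ‖(0 : Matrix (Fin n) (Fin n) ℂ)‖ < 1)))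
    obtain ⟨D, hD⟩ := (isCompact_Icc (a := 0) (b := R)).exists_bound_of_continuousOn
      (hc.mono Icc_subset_Ici_self)
    refine ⟨max D 1, fun x hx => ?_⟩
    rcases le_total x R with h | h
    · exact (hD x ⟨hx, h⟩).trans (le_max_left _ _)
    · exact (hR x h).le.trans (le_max_right _ _)
  set q := ‖(Complex.I * (κ : ℂ)) ^ 2‖
  have hg : IntegrableOn (fun t => D * ‖V t‖ + q * ‖f t‖) (Ioi 0) :=
    (hV.norm.const_mul D).add (hfi.const_mul q)
  have hD0 : 0 ≤ D := (norm_nonneg _).trans (hD 0 le_rfl)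
  refine ⟨‖xDeriv f 0‖ + ∫ t in Ioi (0 : ℝ), (D * ‖V t‖ + q * ‖f t‖), fun x hx => ?_⟩
  rw [hf.1.2 x hx]
  refine (norm_add_le _ _).trans (add_le_add le_rfl ?_)
  have hgi : IntervalIntegrable (fun t => D * ‖V t‖ + q * ‖f t‖) volume 0 x :=
    (intervalIntegrable_iff_integrableOn_Ioc_of_le hx).2 (hg.mono_set Ioc_subset_Ioi_self)
  calc _ ≤ ∫ t in (0 : ℝ)..x, (D * ‖V t‖ + q * ‖f t‖) := by
        refine intervalIntegral.norm_integral_le_of_norm_le hx ?_ hgi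
        refine Eventually.of_forall fun t ht => ?_
        refine (norm_sub_le _ _).trans (add_le_add ((norm_mul_le _ _).trans ?_) (norm_smul _ _).le)
        rw [mul_comm]
        exact mul_le_mul_of_nonneg_right (hD t ht.1.le) (norm_nonneg _)
    _ ≤ _ := by
        rw [intervalIntegral.integral_of_le hx]
        exact setIntegral_mono_set hg (Eventually.of_forall fun t => by positivity)
          (Eventually.of_forall fun _ ht => ht.1)

theorem star_I_mul_sq (κ : ℝ) : star ((Complex.I * (κ : ℂ)) ^ 2) = (Complex.I * κ) ^ 2 := by
  simp [mul_pow]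

theorem IsJostSolution.wronskian_self (hVself : ∀ x : ℝ, 0 < x → (V x).IsHermitian)
    (hV : IntegrableOn V (Ioi 0)) (hκ : 0 < κ)
    (hf : IsJostSolution V (Complex.I * κ) f) {x : ℝ} (hx : 0 ≤ x) :
    (f x)ᴴ * xDeriv f x - (xDeriv f x)ᴴ * f x = 0 := by
  obtain ⟨C, hC⟩ := hf.xDeriv_bounded hV hκ
  have hconst : ∀ y, 0 ≤ y → (f y)ᴴ * xDeriv f y - (xDeriv f y)ᴴ * f y =
      (f 0)ᴴ * xDeriv f 0 - (xDeriv f 0)ᴴ * f 0 := fun y hy =>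
    hf.1.wronskian_eq hVself hV (star_I_mul_sq κ) hf.1 hy
  rw [hconst x hx]
  have hlim : Tendsto (fun y => (f y)ᴴ * xDeriv f y - (xDeriv f y)ᴴ * f y) atTop (𝓝 0) := by
    have hg : Tendsto (fun y => ‖f y‖ * C + C * ‖f y‖) atTop (𝓝 0) := by
      have := (hf.tendsto_zero hκ).norm
      simpa using (this.mul_const C).add (this.const_mul C)
    refine squeeze_zero_norm' ?_ hg
    filter_upwards [eventually_ge_atTop 0] with y hy
    refine (norm_sub_le _ _).trans (add_le_add ((norm_mul_le _ _).trans ?_)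
      ((norm_mul_le _ _).trans ?_))
    · rw [Matrix.l2_opNorm_conjTranspose]
      exact mul_le_mul_of_nonneg_left (hC y hy) (norm_nonneg _)
    · rw [Matrix.l2_opNorm_conjTranspose]
      exact mul_le_mul_of_nonneg_right (hC y hy) (norm_nonneg _)
  refine tendsto_nhds_unique ?_ hlim
  refine tendsto_const_nhds.congr' ?_
  filter_upwards [eventually_ge_atTop 0] with y hy using (hconst y hy).symm

/-- A solution whose Wronskian with the Jost solution vanishes is a multiple of the Jost solution
near infinity. -/
theorem IsJostSolution.eventually_eq_mul (hVself : ∀ x : ℝ, 0 < x → (V x).IsHermitian)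
    (hV : IntegrableOn V (Ioi 0)) (hκ : 0 < κ) (hf : IsJostSolution V (Complex.I * κ) f)
    (hψ : IsSolution V (Complex.I * κ) ψ)
    (h0 : (f 0)ᴴ * xDeriv ψ 0 - (xDeriv f 0)ᴴ * ψ 0 = 0) :
    ∃ M, ∀ᶠ x in atTop, ψ x = f x * M := by
  obtain ⟨R, hR⟩ := eventually_atTop.1 hf.eventually_isUnit
  set a := max R 1 with ha
  have hu : ∀ x, a ≤ x → IsUnit (f x) := fun x hx => hR x ((le_max_left _ _).trans hx)
  have hpos : ∀ x, a ≤ x → 0 < x := fun x hx =>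
    lt_of_lt_of_le one_pos ((le_max_right _ _).trans hx)
  have hder : ∀ x, a ≤ x → HasDerivAt (fun x => Ring.inverse (f x) * ψ x) 0 x := by
    intro x hx
    have hx0 := hpos x hx
    obtain ⟨u, hux⟩ := hu x hx
    have h1 := hf.wronskian_self hVself hV hκ hx0.le
    have h2 := (hf.1.wronskian_eq hVself hV (star_I_mul_sq κ) hψ hx0.le).trans h0
    have hinv : HasFDerivAt Ring.inverse (-((ContinuousLinearMap.mulLeftRight ℝ
        (Matrix (Fin n) (Fin n) ℂ)) ↑u⁻¹) ↑u⁻¹) (f x) := hux ▸ hasFDerivAt_ringInverse (𝕜 := ℝ) u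
    have hd := (hinv.comp_hasDerivAt x (hf.1.hasDerivAt hx0)).mul (hψ.hasDerivAt hx0)
    refine hd.congr_deriv ?_
    set w : Matrix (Fin n) (Fin n) ℂ := ↑u⁻¹ with hw
    have hfw : f x * w = 1 := by rw [← hux, hw, Units.mul_inv]
    have hfi : Ring.inverse (f x) = w := by rw [← hux, Ring.inverse_unit]
    have hsu : IsUnit (f x)ᴴ := (hu x hx).star
    have key : (f x)ᴴ * (xDeriv ψ x - xDeriv f x * (w * ψ x)) = 0 := by
      rw [mul_sub, ← mul_assoc, sub_eq_zero.1 h1, sub_eq_zero.1 h2, mul_assoc _ (f x),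
        ← mul_assoc (f x), hfw, one_mul, sub_self]
    have key2 := sub_eq_zero.1 (hsu.mul_right_eq_zero.1 key)
    rw [key2, Function.comp_apply, hfi]
    simp [mul_assoc]
  refine ⟨Ring.inverse (f a) * ψ a, ?_⟩
  filter_upwards [eventually_ge_atTop a] with x hx
  have hc := constant_of_has_deriv_right_zero (f := fun x => Ring.inverse (f x) * ψ x) (a := a)
    (b := x) (fun y hy => (hder y hy.1).continuousAt.continuousWithinAt)
    (fun y hy => (hder y hy.1).hasDerivWithinAt) x (right_mem_Icc.2 hx)
  rw [← show Ring.inverse (f x) * ψ x = _ from hc, ← mul_assoc, Ring.mul_inverse_cancel _ (hu x hx), one_mul]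

theorem IsSolution.integrableOn_gram (hVself : ∀ x : ℝ, 0 < x → (V x).IsHermitian)
    (hV : IntegrableOn V (Ioi 0)) (hκ : 0 < κ) (hf : IsJostSolution V (Complex.I * κ) f)
    (hψ : IsSolution V (Complex.I * κ) ψ)
    (h0 : (f 0)ᴴ * xDeriv ψ 0 - (xDeriv f 0)ᴴ * ψ 0 = 0) :
    IntegrableOn (fun x => (ψ x)ᴴ * ψ x) (Ioi 0) := by
  obtain ⟨M, hM⟩ := hf.eventually_eq_mul hVself hV hκ hψ h0
  have hO : ψ =O[atTop] fun x => Real.exp (-κ * x) := by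
    have h1 : (fun x => f x * M) =O[atTop] fun x => Real.exp (-κ * x) :=
      (Asymptotics.IsBigO.of_bound ‖M‖ (Eventually.of_forall fun x => by
        rw [mul_comm]; exact norm_mul_le _ _)).trans hf.isBigO_exp
    exact h1.congr' (hM.mono fun x hx => hx.symm) EventuallyEq.rfl
  have hc := hψ.continuousOn
  have hcg : ContinuousOn (fun x => (ψ x)ᴴ * ψ x) (Ici 0) := (hc.star).mul hc
  have hn : IntegrableOn (fun x => ‖(ψ x)ᴴ * ψ x‖) (Ioi 0) := by
    refine integrable_of_isBigO_exp_neg (b := κ + κ) (by linarith) hcg.norm ?_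
    have h2 := (hO.norm_left.mul hO.norm_left)
    refine (Asymptotics.IsBigO.of_bound 1 (Eventually.of_forall fun x => ?_)).trans
      (h2.congr_right fun x => ?_)
    · simpa [Matrix.l2_opNorm_conjTranspose] using norm_mul_le (ψ x)ᴴ (ψ x)
    · rw [← Real.exp_add]; ring_nf
  exact (integrable_norm_iff ((hcg.mono Ioi_subset_Ici_self).aestronglyMeasurable
    measurableSet_Ioi)).1 hn

end Decay

section LinearAlgebra

variable {n : ℕ} {Q T W : Matrix (Fin n) (Fin n) ℂ}

theorem kernelProjection_isHermitian (M : Matrix (Fin n) (Fin n) ℂ) :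
    (kernelProjection M)ᴴ = kernelProjection M := by
  have : IsSelfAdjoint (LinearMap.ker (Matrix.toEuclideanLin M)).starProjection :=
    isSelfAdjoint_starProjection _
  exact ((map_star (Matrix.toEuclideanCLM (n := Fin n) (𝕜 := ℂ)).symm _).symm).trans
    (congrArg _ this.star_eq)

theorem kernelProjection_mul_self (M : Matrix (Fin n) (Fin n) ℂ) :
    kernelProjection M * kernelProjection M = kernelProjection M := by
  unfold kernelProjection
  rw [← map_mul, Submodule.isIdempotentElem_starProjection]

theorem mul_kernelProjection (M : Matrix (Fin n) (Fin n) ℂ) : M * kernelProjection M = 0 := by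
  apply (Matrix.toEuclideanCLM (n := Fin n) (𝕜 := ℂ)).injective
  have h : Matrix.toEuclideanCLM (n := Fin n) (𝕜 := ℂ) (kernelProjection M) =
      (LinearMap.ker (Matrix.toEuclideanLin M)).starProjection :=
    StarAlgEquiv.apply_symm_apply _ _
  refine (map_mul (Matrix.toEuclideanCLM (n := Fin n) (𝕜 := ℂ)) _ _).trans ?_
  rw [h, map_zero]
  ext1 v
  exact Submodule.starProjection_apply_mem (LinearMap.ker (Matrix.toEuclideanLin M)) v

theorem mul_inv_of_commute (hT : IsUnit T) (h : Q * T = T * Q) : Q * T⁻¹ = T⁻¹ * Q := by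
  have hd := (Matrix.isUnit_iff_isUnit_det T).1 hT
  calc Q * T⁻¹ = T⁻¹ * (T * Q) * T⁻¹ := by
        rw [← Matrix.mul_assoc, Matrix.nonsing_inv_mul _ hd, Matrix.one_mul]
    _ = T⁻¹ * Q := by
        rw [← h, Matrix.mul_assoc, Matrix.mul_assoc, Matrix.mul_nonsing_inv _ hd, Matrix.mul_one]

theorem exists_inverse_on_range (hQ : Qᴴ = Q) (hQQ : Q * Q = Q) (hQW : Q * W = W)
    (hWQ : W * Q = W) (hT : IsUnit (1 - Q + W)) :
    ∃ X, X * W = Q ∧ W * X = Q ∧ X * Q = X ∧ Q * X = X ∧ IsMoorePenroseInverse W X := by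
  have hd := (Matrix.isUnit_iff_isUnit_det _).1 hT
  have h1 : (1 - Q + W) * Q = W := by simp [add_mul, sub_mul, hQQ, hWQ]
  have h2 : Q * (1 - Q + W) = W := by simp [mul_add, mul_sub, hQQ, hQW]
  have hc := mul_inv_of_commute hT (h2.trans h1.symm)
  set D := (1 - Q + W)⁻¹ with hD
  have e1 : D * Q * W = Q := by
    rw [Matrix.mul_assoc, hQW]
    nth_rewrite 1 [← h1]
    rw [← Matrix.mul_assoc, Matrix.nonsing_inv_mul _ hd, Matrix.one_mul]
  have e2 : W * (D * Q) = Q := by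
    rw [← hc, ← Matrix.mul_assoc, hWQ]
    nth_rewrite 1 [← h2]
    rw [Matrix.mul_assoc, Matrix.mul_nonsing_inv _ hd, Matrix.mul_one]
  have e3 : D * Q * Q = D * Q := by rw [Matrix.mul_assoc, hQQ]
  have e4 : Q * (D * Q) = D * Q := by rw [← hc, ← Matrix.mul_assoc, hQQ]
  exact ⟨D * Q, e1, e2, e3, e4, by rw [e2, hQW], by rw [e1, e4], by rw [e2, hQ], by rw [e1, hQ]⟩

theorem bijOn_range_of_inverse {X : Matrix (Fin n) (Fin n) ℂ} (h1 : X * W = Q) (h2 : W * X = Q)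
    (hQW : Q * W = W) (hQX : Q * X = X) (hQQ : Q * Q = Q) :
    BijOn (fun v : Fin n → ℂ => W *ᵥ v) (range fun v : Fin n → ℂ => Q *ᵥ v)
      (range fun v : Fin n → ℂ => Q *ᵥ v) := by
  refine InvOn.bijOn (f' := fun v => X *ᵥ v) ⟨?_, ?_⟩ ?_ ?_
  · rintro _ ⟨v, rfl⟩
    simp only [Matrix.mulVec_mulVec]
    rw [← Matrix.mul_assoc, h1, hQQ]
  · rintro _ ⟨v, rfl⟩
    simp only [Matrix.mulVec_mulVec]
    rw [← Matrix.mul_assoc, h2, hQQ]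
  · rintro _ ⟨v, rfl⟩
    exact ⟨W *ᵥ (Q *ᵥ v), by simp only [Matrix.mulVec_mulVec]; rw [← Matrix.mul_assoc, hQW]⟩
  · rintro _ ⟨v, rfl⟩
    exact ⟨X *ᵥ (Q *ᵥ v), by simp only [Matrix.mulVec_mulVec]; rw [← Matrix.mul_assoc, hQX]⟩

theorem sqrt_inv_spec {H : Matrix (Fin n) (Fin n) ℂ} (hH : H.PosDef) (hc : Q * H = H * Q) :
    IsUnit (CFC.sqrt H)⁻¹ ∧ ((CFC.sqrt H)⁻¹)ᴴ = (CFC.sqrt H)⁻¹ ∧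
      Q * (CFC.sqrt H)⁻¹ = (CFC.sqrt H)⁻¹ * Q ∧ (CFC.sqrt H)⁻¹ * H * (CFC.sqrt H)⁻¹ = 1 ∧
      (CFC.sqrt H)⁻¹ * (CFC.sqrt H)⁻¹ * H = 1 := by
  have h0 : 0 ≤ H := hH.posSemidef.nonneg
  have hss : CFC.sqrt H * CFC.sqrt H = H := CFC.sqrt_mul_sqrt_self H h0
  have hu : IsUnit (CFC.sqrt H) := (CFC.isUnit_sqrt_iff H h0).2 hH.isUnit
  have hd := (Matrix.isUnit_iff_isUnit_det _).1 hu
  have hsa : (CFC.sqrt H)ᴴ = CFC.sqrt H := (CFC.sqrt_nonneg H).isSelfAdjoint.star_eq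
  have hcs : Commute (CFC.sqrt H) Q := by
    rw [CFC.sqrt]
    exact Commute.cfcₙ_nnreal (show Commute H Q from hc.symm) _
  refine ⟨(Matrix.isUnit_nonsing_inv_iff).2 hu, ?_, mul_inv_of_commute hu hcs.symm, ?_, ?_⟩
  · rw [Matrix.conjTranspose_nonsing_inv, hsa]
  · nth_rewrite 2 [← hss]
    rw [← Matrix.mul_assoc, Matrix.nonsing_inv_mul _ hd, Matrix.one_mul,
      Matrix.mul_nonsing_inv _ hd]
  · nth_rewrite 3 [← hss]
    rw [Matrix.mul_assoc, ← Matrix.mul_assoc _ (CFC.sqrt H), Matrix.nonsing_inv_mul _ hd,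
      Matrix.one_mul, Matrix.nonsing_inv_mul _ hd]

end LinearAlgebra

section GramMatrices

variable {n : ℕ} {ψ : ℝ → Matrix (Fin n) (Fin n) ℂ} {Q : Matrix (Fin n) (Fin n) ℂ}

theorem setIntegral_mul_mul {F : ℝ → Matrix (Fin n) (Fin n) ℂ} {s : Set ℝ} (h : IntegrableOn F s)
    (L R : Matrix (Fin n) (Fin n) ℂ) : ∫ x in s, L * F x * R = L * (∫ x in s, F x) * R :=
  ((ContinuousLinearMap.mulLeftRight ℝ (Matrix (Fin n) (Fin n) ℂ) L) R).integral_comp_comm h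

theorem intervalIntegral_mul_mul {F : ℝ → Matrix (Fin n) (Fin n) ℂ} {a b : ℝ}
    (h : IntervalIntegrable F volume a b) (L R : Matrix (Fin n) (Fin n) ℂ) :
    ∫ x in a..b, L * F x * R = L * (∫ x in a..b, F x) * R :=
  ((ContinuousLinearMap.mulLeftRight ℝ (Matrix (Fin n) (Fin n) ℂ) L) R).intervalIntegral_comp_comm h

/-- The quadratic form of a Gram matrix `∫ₓ^∞ ψ† ψ` is nonnegative, and it vanishes only on vectors
annihilated by `ψ` beyond `x`. -/
theorem dotProduct_tailGram {x : ℝ} (hc : ContinuousOn ψ (Ioi x))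
    (hi : IntegrableOn (fun z => (ψ z)ᴴ * ψ z) (Ioi x)) (v : Fin n → ℂ) :
    0 ≤ star v ⬝ᵥ (tailGram ψ x *ᵥ v) ∧
      (star v ⬝ᵥ (tailGram ψ x *ᵥ v) = 0 → ∀ z, x < z → ψ z *ᵥ v = 0) := by
  let L : Matrix (Fin n) (Fin n) ℂ →L[ℂ] ℂ := LinearMap.toContinuousLinearMap
    { toFun := fun M => star v ⬝ᵥ (M *ᵥ v)
      map_add' := fun M N => by rw [Matrix.add_mulVec, dotProduct_add]
      map_smul' := fun c M => by rw [Matrix.smul_mulVec, dotProduct_smul, RingHom.id_apply] }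
  have hL : ∀ M, L M = star v ⬝ᵥ (M *ᵥ v) := fun M => rfl
  set r : ℝ → ℝ := fun z => ∑ i, ‖(ψ z *ᵥ v) i‖ ^ 2 with hr
  have hLr : ∀ z, L ((ψ z)ᴴ * ψ z) = (r z : ℂ) := by
    intro z
    rw [hL, ← Matrix.mulVec_mulVec, Matrix.dotProduct_mulVec, ← Matrix.star_mulVec, hr]
    simp [dotProduct, Complex.conj_mul']
  have hr0 : ∀ z, 0 ≤ r z := fun z => Finset.sum_nonneg fun i _ => by positivity
  have hri : IntegrableOn r (Ioi x) := by
    have h1 : IntegrableOn (fun z => L ((ψ z)ᴴ * ψ z)) (Ioi x) := L.integrable_comp hi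
    simp only [hLr] at h1
    exact h1.re
  have hform : star v ⬝ᵥ (tailGram ψ x *ᵥ v) = ((∫ z in Ioi x, r z : ℝ) : ℂ) := by
    rw [← hL, tailGram, ← L.integral_comp_comm hi]
    simp only [hLr]
    exact integral_ofReal
  rw [hform]
  refine ⟨by exact_mod_cast integral_nonneg hr0, fun h z hz => ?_⟩
  have h0 : ∫ z in Ioi x, r z = 0 := by exact_mod_cast h
  rw [setIntegral_eq_zero_iff_of_nonneg_ae (Eventually.of_forall hr0) hri] at h0
  have hcv : ContinuousOn (fun z => ψ z *ᵥ v) (Ioi x) :=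
    (Continuous.matrix_mulVec continuous_id continuous_const).comp_continuousOn hc
  have hrc : ContinuousOn r (Ioi x) :=
    continuousOn_finsetSum _ fun i _ =>
      (((continuous_apply i).comp_continuousOn hcv).norm).pow 2
  have := Measure.eqOn_open_of_ae_eq h0 isOpen_Ioi hrc continuousOn_const hz
  have hz0 := (Finset.sum_eq_zero_iff_of_nonneg fun i _ => by positivity).1 this
  ext i
  simpa using hz0 i (Finset.mem_univ i)

theorem posDef_one_sub_add_tailGram (hQ : Qᴴ = Q) (hQQ : Q * Q = Q) {x : ℝ}
    (hc : ContinuousOn ψ (Ioi x)) (hi : IntegrableOn (fun z => (ψ z)ᴴ * ψ z) (Ioi x))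
    (hinj : ∀ v, (∀ z, x < z → ψ z *ᵥ v = 0) → Q *ᵥ v = 0) :
    (1 - Q + tailGram ψ x).PosDef := by
  have hP : (1 - Q)ᴴ * (1 - Q) = 1 - Q := by
    simp [hQ, mul_sub, sub_mul, hQQ]
  refine Matrix.PosDef.of_dotProduct_mulVec_pos ?_ fun v hv => ?_
  · refine Matrix.IsHermitian.add (by simp [Matrix.IsHermitian, hQ]) ?_
    have := ((starL' ℝ : Matrix (Fin n) (Fin n) ℂ ≃L[ℝ] Matrix (Fin n) (Fin n) ℂ) :
      Matrix (Fin n) (Fin n) ℂ →L[ℝ] Matrix (Fin n) (Fin n) ℂ).integral_comp_comm hi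
    refine this.symm.trans ?_
    simp [tailGram, Matrix.star_eq_conjTranspose]
  · obtain ⟨h1, h2⟩ := dotProduct_tailGram hc hi v
    have h3 : star v ⬝ᵥ ((1 - Q) *ᵥ v) = star ((1 - Q) *ᵥ v) ⬝ᵥ ((1 - Q) *ᵥ v) := by
      rw [Matrix.star_mulVec, ← Matrix.dotProduct_mulVec, Matrix.mulVec_mulVec, hP]
    have h4 : 0 ≤ star v ⬝ᵥ ((1 - Q) *ᵥ v) := h3 ▸ dotProduct_star_self_nonneg _
    rw [Matrix.add_mulVec, dotProduct_add]
    refine lt_of_le_of_ne (add_nonneg h4 h1) fun h => hv ?_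
    obtain ⟨h5, h6⟩ := (add_eq_zero_iff_of_nonneg h4 h1).1 h.symm
    have h7 := dotProduct_star_self_eq_zero.1 (h3.symm.trans h5)
    rw [Matrix.sub_mulVec, hinj v (h2 h6)] at h7
    simpa using h7

end GramMatrices

section Normalization

variable {n : ℕ} {φ : ℝ → Matrix (Fin n) (Fin n) ℂ} {Q : Matrix (Fin n) (Fin n) ℂ}

theorem gram_mul (φ : ℝ → Matrix (Fin n) (Fin n) ℂ) (hQ : Qᴴ = Q) :
    (fun x => Q * (φ x)ᴴ * φ x * Q) = fun x => (φ x * Q)ᴴ * (φ x * Q) := by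
  funext x
  rw [Matrix.conjTranspose_mul, hQ, Matrix.mul_assoc, Matrix.mul_assoc]

/-- The properties of the normalization matrix, of the normalized solution, and of its Gram matrix
that follow from positivity of `normalizationGram`. -/
theorem normalization_spec (hQ : Qᴴ = Q) (hQQ : Q * Q = Q)
    (hi : IntegrableOn (fun x => Q * (φ x)ᴴ * φ x * Q) (Ioi 0))
    (hH : (normalizationGram Q φ).PosDef) :
    (normalizationMatrix Q φ)ᴴ = normalizationMatrix Q φ ∧
      normalizationMatrix Q φ * Q = normalizationMatrix Q φ ∧
      (∀ v, normalizationMatrix Q φ *ᵥ v = 0 → Q *ᵥ v = 0) ∧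
      IntegrableOn (fun x => (normalizedSolution Q φ x)ᴴ * normalizedSolution Q φ x) (Ioi 0) ∧
      tailGram (normalizedSolution Q φ) 0 = Q := by
  set N := ∫ x in Ioi (0 : ℝ), Q * (φ x)ᴴ * φ x * Q with hN
  have hQN : Q * N = N := by
    have := setIntegral_mul_mul hi Q 1
    simp only [Matrix.mul_one] at this
    rw [hN, ← this]
    simp only [← Matrix.mul_assoc, hQQ]
  have hNQ : N * Q = N := by
    have := setIntegral_mul_mul hi 1 Q
    simp only [Matrix.one_mul] at this
    rw [hN, ← this]
    simp only [Matrix.mul_assoc, hQQ]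
  have hHdef : normalizationGram Q φ = 1 - Q + N := rfl
  have hcomm : Q * normalizationGram Q φ = normalizationGram Q φ * Q := by
    simp [hHdef, mul_add, add_mul, mul_sub, sub_mul, hQQ, hQN, hNQ]
  obtain ⟨hu, hs, hc, h1, h2⟩ := sqrt_inv_spec hH hcomm
  have hCdef : normalizationMatrix Q φ = (CFC.sqrt (normalizationGram Q φ))⁻¹ * Q := rfl
  set D := (CFC.sqrt (normalizationGram Q φ))⁻¹
  have hCs : (normalizationMatrix Q φ)ᴴ = normalizationMatrix Q φ := by
    rw [hCdef, Matrix.conjTranspose_mul, hQ, hs, hc]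
  have hprod : (fun x => (normalizedSolution Q φ x)ᴴ * normalizedSolution Q φ x) =
      fun x => D * (Q * (φ x)ᴴ * φ x * Q) * D := by
    funext x
    rw [normalizedSolution, Matrix.conjTranspose_mul, hCs, hCdef]
    nth_rewrite 2 [← hc]
    simp only [Matrix.mul_assoc]
  refine ⟨hCs, by rw [hCdef, Matrix.mul_assoc, hQQ], fun v hv => ?_, ?_, ?_⟩
  · rw [hCdef, ← Matrix.mulVec_mulVec] at hv
    exact (Matrix.mulVec_injective_of_isUnit hu) (hv.trans (Matrix.mulVec_zero _).symm)
  · rw [hprod]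
    exact (hi.const_mul D).mul_const D
  · have h3 : normalizationGram Q φ * (1 - Q) = 1 - Q := by
      simp [hHdef, mul_sub, add_mul, sub_mul, hQQ, hNQ]
    have h4 : D * D * (1 - Q) = 1 - Q := by
      nth_rewrite 1 [← h3]
      rw [← Matrix.mul_assoc, h2, Matrix.one_mul]
    have h5 : D * (1 - Q) * D = 1 - Q := by
      rw [Matrix.mul_assoc, sub_mul, Matrix.one_mul, hc]
      nth_rewrite 2 [← Matrix.mul_one D]
      rw [← mul_sub, ← Matrix.mul_assoc, h4]
    rw [tailGram, hprod, setIntegral_mul_mul hi, ← hN,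
      show N = normalizationGram Q φ - (1 - Q) by rw [hHdef]; abel, mul_sub, sub_mul, h1, h5,
      sub_sub_cancel]

end Normalization

section GelfandLevitan

variable {n : ℕ} {Φ : ℝ → Matrix (Fin n) (Fin n) ℂ} {Q : Matrix (Fin n) (Fin n) ℂ}

theorem tailGram_mul (hΦQ : ∀ x, Φ x * Q = Φ x) {x : ℝ}
    (hi : IntegrableOn (fun z => (Φ z)ᴴ * Φ z) (Ioi x)) : tailGram Φ x * Q = tailGram Φ x := by
  have := setIntegral_mul_mul hi 1 Q
  simp only [Matrix.one_mul] at this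
  rw [tailGram, ← this]
  simp only [Matrix.mul_assoc, hΦQ]

theorem mul_tailGram (hQ : Qᴴ = Q) (hΦQ : ∀ x, Φ x * Q = Φ x) {x : ℝ}
    (hi : IntegrableOn (fun z => (Φ z)ᴴ * Φ z) (Ioi x)) : Q * tailGram Φ x = tailGram Φ x := by
  have h : ∀ z, Q * (Φ z)ᴴ = (Φ z)ᴴ := fun z => by
    nth_rewrite 2 [← hΦQ z]
    rw [Matrix.conjTranspose_mul, hQ]
  have := setIntegral_mul_mul hi Q 1
  simp only [Matrix.mul_one] at this
  rw [tailGram, ← this]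
  simp only [← Matrix.mul_assoc, h]

theorem intervalIntegral_gram (hi : IntegrableOn (fun z => (Φ z)ᴴ * Φ z) (Ioi 0)) {x : ℝ}
    (hx : 0 ≤ x) :
    ∫ z in (0 : ℝ)..x, (Φ z)ᴴ * Φ z = tailGram Φ 0 - tailGram Φ x := by
  rw [eq_sub_iff_add_eq, tailGram, tailGram, intervalIntegral.integral_of_le hx,
    ← setIntegral_union Ioc_disjoint_Ioi_same measurableSet_Ioi (hi.mono_set Ioc_subset_Ioi_self)
      (hi.mono_set (Ioi_subset_Ioi hx)), Ioc_union_Ioi_eq_Ioi hx]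

variable {G : ℝ → ℝ → Matrix (Fin n) (Fin n) ℂ}

theorem isGelfandLevitanSolution_of_gram (hc : ContinuousOn Φ (Ici 0))
    (hΦQ : ∀ x, Φ x * Q = Φ x) (hi : IntegrableOn (fun z => (Φ z)ᴴ * Φ z) (Ioi 0))
    (h0 : tailGram Φ 0 = Q) (hG : ∀ x y, G x y = -(Φ x * (Φ y)ᴴ))
    {X : ℝ → Matrix (Fin n) (Fin n) ℂ}
    (hX : ∀ x, 0 ≤ x → X x * tailGram Φ x = Q ∧ X x * Q = X x) :
    IsGelfandLevitanSolution G fun x y => Φ x * X x * (Φ y)ᴴ := by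
  intro x hx
  have hcx : ContinuousOn Φ (uIcc 0 x) := hc.mono (uIcc_subset_Ici_zero le_rfl hx.le)
  refine ⟨(continuousOn_const.mul hcx.star).intervalIntegrable, fun y hy hyx => ?_⟩
  obtain ⟨h1, h2⟩ := hX x hx.le
  have hgi : IntervalIntegrable (fun z => (Φ z)ᴴ * Φ z) volume 0 x :=
    (hcx.star.mul hcx).intervalIntegrable
  have e : ∀ z, Φ x * X x * (Φ z)ᴴ * G z y = Φ x * X x * ((Φ z)ᴴ * Φ z) * -(Φ y)ᴴ := fun z => by
    rw [hG]; simp only [Matrix.mul_neg, Matrix.mul_assoc]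
  simp only [e]
  rw [intervalIntegral_mul_mul hgi, intervalIntegral_gram hi hx.le, h0, hG, mul_sub,
    Matrix.mul_assoc _ _ Q, h2, Matrix.mul_assoc _ _ (tailGram Φ x), h1, hΦQ, sub_mul,
    Matrix.mul_neg, Matrix.mul_neg]
  abel

theorem gelfandLevitanSolution_unique (hc : ContinuousOn Φ (Ici 0))
    (hΦQ : ∀ x, Φ x * Q = Φ x) (hi : IntegrableOn (fun z => (Φ z)ᴴ * Φ z) (Ioi 0))
    (h0 : tailGram Φ 0 = Q) (hG : ∀ x y, G x y = -(Φ x * (Φ y)ᴴ))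
    {X : ℝ → Matrix (Fin n) (Fin n) ℂ}
    (hX : ∀ x, 0 ≤ x → tailGram Φ x * X x = Q)
    (hWQ : ∀ x, 0 ≤ x → tailGram Φ x * Q = tailGram Φ x) (hQQ : Q * Q = Q)
    {a : ℝ → ℝ → Matrix (Fin n) (Fin n) ℂ} (ha : IsGelfandLevitanSolution G a)
    {x y : ℝ} (hy : 0 ≤ y) (hyx : y < x) : a x y = Φ x * X x * (Φ y)ᴴ := by
  have hx : 0 < x := hy.trans_lt hyx
  obtain ⟨hai, hae⟩ := ha x hx
  have hcx : ContinuousOn Φ (uIcc 0 x) := hc.mono (uIcc_subset_Ici_zero le_rfl hx.le)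
  have hgi : IntervalIntegrable (fun z => (Φ z)ᴴ * Φ z) volume 0 x :=
    (hcx.star.mul hcx).intervalIntegrable
  have hap : IntervalIntegrable (fun z => a x z * Φ z) volume 0 x := hai.mul_continuousOn hcx
  set P := ∫ z in (0 : ℝ)..x, a x z * Φ z with hP
  have hform : ∀ y, 0 ≤ y → y < x → a x y = (Φ x + P) * (Φ y)ᴴ := by
    intro y hy hyx
    have h := hae y hy hyx
    have e : ∀ z, a x z * G z y = 1 * (a x z * Φ z) * -(Φ y)ᴴ := fun z => by
      rw [hG]; simp only [Matrix.mul_neg, Matrix.mul_assoc, Matrix.one_mul]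
    simp only [e] at h
    rw [intervalIntegral_mul_mul hap, hG, ← hP, Matrix.one_mul, Matrix.mul_neg] at h
    rw [add_mul, ← sub_eq_zero, ← h]
    abel
  have hPe : P = (Φ x + P) * (Q - tailGram Φ x) := by
    rw [← h0, ← intervalIntegral_gram hi hx.le]
    have hm := intervalIntegral_mul_mul hgi (Φ x + P) 1
    simp only [Matrix.mul_one] at hm
    rw [← hm, hP]
    refine intervalIntegral.integral_congr_ae ?_
    have hne : ∀ᵐ t : ℝ, t ≠ x := by simp [ae_iff, measure_singleton]
    filter_upwards [hne] with z hz hz'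
    rw [uIoc_of_le hx.le] at hz'
    rw [hform z hz'.1.le (lt_of_le_of_ne hz'.2 hz), Matrix.mul_assoc]
  have hPQ : P * Q = P := by
    rw [hPe, Matrix.mul_assoc, sub_mul, hQQ, hWQ x hx.le]
  have hMQ : (Φ x + P) * Q = Φ x + P := by rw [add_mul, hΦQ, hPQ]
  have hMW : (Φ x + P) * tailGram Φ x = Φ x := by
    rw [mul_sub, hMQ] at hPe
    have := congrArg (fun R => Φ x + P - R) hPe
    simpa using this.symm
  rw [hform y hy hyx]
  congr 1
  rw [← hMQ, ← hX x hx.le, ← Matrix.mul_assoc, hMW]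

end GelfandLevitan

end MatrixSchrodinger

theorem theorem6p1 {n : ℕ}
    (V : ℝ → Matrix (Fin n) (Fin n) ℂ)
    (hVself : ∀ x : ℝ, 0 < x → (V x).IsHermitian)
    (hVint : IntegrableOn (fun x : ℝ => (1 + x) • V x) (Ioi 0))
    (A B : Matrix (Fin n) (Fin n) ℂ)
    (hAB : -(Bᴴ * A) + Aᴴ * B = 0)
    (hABpos : (Aᴴ * A + Bᴴ * B).PosDef)
    (φ : ℂ → ℝ → Matrix (Fin n) (Fin n) ℂ)
    (hφ : ∀ k : ℂ, IsRegularSolution V A B k (φ k))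
    (f : ℂ → ℝ → Matrix (Fin n) (Fin n) ℂ)
    (hf : ∀ k : ℂ, 0 ≤ k.im → k ≠ 0 → IsJostSolution V k (f k))
    (κ : ℝ) (hκ : 0 < κ)
    (hdet : (jostMatrix f A B (Complex.I * κ)).det = 0)
    (Q C : Matrix (Fin n) (Fin n) ℂ)
    (hQ : Q = kernelProjection (jostMatrix f A B (Complex.I * κ)))
    (hC : C = normalizationMatrix Q (φ (Complex.I * κ)))
    (Φ W : ℝ → Matrix (Fin n) (Fin n) ℂ)
    (hΦ : Φ = normalizedSolution Q (φ (Complex.I * κ)))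
    (hW : W = tailGram Φ)
    (G 𝒜 : ℝ → ℝ → Matrix (Fin n) (Fin n) ℂ)
    (hG : ∀ x y : ℝ, G x y = -(φ (Complex.I * κ) x * C ^ 2 * (φ (Complex.I * κ) y)ᴴ))
    (h𝒜 : ∀ x y : ℝ, 𝒜 x y = Φ x * moorePenroseInverse (W x) * (Φ y)ᴴ) :
    -- the integrals and the square root in the definitions of `C` and `W` are meaningful
    IntegrableOn
        (fun x => Q * (φ (Complex.I * κ) x)ᴴ * φ (Complex.I * κ) x * Q) (Ioi 0) ∧
      (normalizationGram Q (φ (Complex.I * κ))).PosDef ∧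
      IntegrableOn (fun x => (Φ x)ᴴ * Φ x) (Ioi 0) ∧
      -- `W x` is invertible on the range of `Q`
      (∀ x : ℝ, 0 ≤ x →
        BijOn (fun v : Fin n → ℂ => W x *ᵥ v)
          (range fun v : Fin n → ℂ => Q *ᵥ v) (range fun v : Fin n → ℂ => Q *ᵥ v)) ∧
      -- `𝒜` is the solution of the Gel'fand–Levitan system, and the only one
      IsGelfandLevitanSolution G 𝒜 ∧
      ∀ a : ℝ → ℝ → Matrix (Fin n) (Fin n) ℂ, IsGelfandLevitanSolution G a →
        ∀ x y : ℝ, 0 ≤ y → y < x → a x y = 𝒜 x y := by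
  have hV := integrableOn_of_integrableOn_weighted hVint
  have hk : -(starRingEnd ℂ (Complex.I * κ)) = Complex.I * κ := by simp
  have hf' := hf (Complex.I * κ) (by simpa using hκ.le) (by simp [hκ.ne'])
  have hφ' := hφ (Complex.I * κ)
  have hJ := mul_kernelProjection (jostMatrix f A B (Complex.I * κ))
  have hQs := kernelProjection_isHermitian (jostMatrix f A B (Complex.I * κ))
  have hQQ := kernelProjection_mul_self (jostMatrix f A B (Complex.I * κ))
  rw [← hQ] at hJ hQs hQQ
  rw [jostMatrix, hk] at hJ
  set ψ := φ (Complex.I * κ) with hψ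
  obtain ⟨hsQ, hdQ⟩ := hφ'.1.mul_const hV Q
  have hgram : IntegrableOn (fun x => (ψ x * Q)ᴴ * (ψ x * Q)) (Ioi 0) := by
    refine hsQ.integrableOn_gram hVself hV hκ hf' ?_
    rw [hdQ 0 le_rfl, hφ'.2.1, hφ'.2.2, ← Matrix.mul_assoc, ← Matrix.mul_assoc, ← sub_mul, hJ]
  have hint : IntegrableOn (fun x => Q * (ψ x)ᴴ * ψ x * Q) (Ioi 0) := by rwa [gram_mul ψ hQs]
  have hH : (normalizationGram Q ψ).PosDef := by
    rw [normalizationGram, gram_mul ψ hQs]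
    refine posDef_one_sub_add_tailGram hQs hQQ
      (hsQ.continuousOn.mono Ioi_subset_Ici_self) hgram fun v hv => ?_
    refine hφ'.mulVec_eq_zero hV hABpos le_rfl fun z hz => ?_
    rw [Matrix.mulVec_mulVec, hv z hz]
  obtain ⟨hCs, hCQ, hCinj, hΦi, hΦ0⟩ := normalization_spec hQs hQQ hint hH
  rw [← hC] at hCs hCQ hCinj
  rw [← hΦ] at hΦi hΦ0
  have hΦC : ∀ x, Φ x = ψ x * C := fun x => by rw [hΦ, hC]; rfl
  have hΦc : ContinuousOn Φ (Ici 0) :=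
    (hφ'.1.mul_const hV C).1.continuousOn.congr fun x _ => hΦC x
  have hΦQ : ∀ x, Φ x * Q = Φ x := fun x => by rw [hΦC, Matrix.mul_assoc, hCQ]
  have hGΦ : ∀ x y, G x y = -(Φ x * (Φ y)ᴴ) := fun x y => by
    rw [hG, hΦC, hΦC, Matrix.conjTranspose_mul, hCs, pow_two]
    simp only [Matrix.mul_assoc]
  have htail : ∀ x : ℝ, 0 ≤ x → IntegrableOn (fun z => (Φ z)ᴴ * Φ z) (Ioi x) := fun x hx =>
    hΦi.mono_set (Ioi_subset_Ioi hx)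
  have hWinv : ∀ x, 0 ≤ x → W x * moorePenroseInverse (W x) = Q ∧
      moorePenroseInverse (W x) * W x = Q ∧
      moorePenroseInverse (W x) * Q = moorePenroseInverse (W x) ∧
      Q * moorePenroseInverse (W x) = moorePenroseInverse (W x) ∧
      Q * W x = W x ∧ W x * Q = W x := by
    intro x hx
    have hQW : Q * W x = W x := hW ▸ mul_tailGram hQs hΦQ (htail x hx)
    have hWQ : W x * Q = W x := hW ▸ tailGram_mul hΦQ (htail x hx)
    have hpos : (1 - Q + W x).PosDef := by
      rw [hW]
      refine posDef_one_sub_add_tailGram hQs hQQ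
        (hΦc.mono fun z hz => hx.trans (le_of_lt hz)) (htail x hx) fun v hv => hCinj v ?_
      refine hφ'.mulVec_eq_zero hV hABpos hx fun z hz => ?_
      rw [Matrix.mulVec_mulVec, ← hΦC, hv z hz]
    obtain ⟨X, h1, h2, h3, h4, h5⟩ := exists_inverse_on_range hQs hQQ hQW hWQ hpos.isUnit
    rw [← h5.unique (moorePenroseInverse_spec (W x))]
    exact ⟨h2, h1, h3, h4, hQW, hWQ⟩
  have h𝒜' : 𝒜 = fun x y => Φ x * moorePenroseInverse (W x) * (Φ y)ᴴ :=
    funext fun x => funext fun y => h𝒜 x y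
  refine ⟨hint, hH, hΦi, fun x hx => ?_, ?_, fun a ha x y hy hyx => ?_⟩
  · obtain ⟨h1, h2, -, h4, h5, -⟩ := hWinv x hx
    exact bijOn_range_of_inverse h2 h1 h5 h4 hQQ
  · rw [h𝒜']
    refine isGelfandLevitanSolution_of_gram hΦc hΦQ hΦi hΦ0 hGΦ
      (X := fun x => moorePenroseInverse (W x)) fun x hx => ?_
    rw [← hW]
    exact ⟨(hWinv x hx).2.1, (hWinv x hx).2.2.1⟩
  · rw [h𝒜]
    exact gelfandLevitanSolution_unique hΦc hΦQ hΦi hΦ0 hGΦ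
      (X := fun x => moorePenroseInverse (W x)) (fun x hx => by rw [← hW]; exact (hWinv x hx).1)
      (fun x hx => by rw [← hW]; exact (hWinv x hx).2.2.2.2.2) hQQ ha hy hyx
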